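/- Let $R$ be an associative ring with unit. A left $R$-module $N$ is called super finitely presented if there is an exact sequence $\cdots\to F_1\to F_0\to N\to 0$ with every $F_i$ finitely generated and projective. The weak flat dimension $\mathrm{wfd}_R(M)$ of a right $R$-module $M$ is the smallest integer $n\ge 0$ such that $\mathrm{Tor}^R_{n+1}(M,N)=0$ for every super finitely presented left $R$-module $N$ (and $\infty$ if there is no such $n$). For $n\ge 0$, let $\mathcal{WF}_{\le n}$ be the class of right $R$-modules $M$ with $\mathrm{wfd}_R(M)\le n$. Then, for every $n\ge 0$, the class $\mathcal{WF}_{\le n}$ is closed under arbitrary direct products, and it is preenveloping: for every right $R$-module $M$ there are a module $X\in\mathcal{WF}_{\le n}$ and a homomorphism $\varphi\colon M\to X$ such that every homomorphism $f\colon M\to X'$ with $X'\in\mathcal{WF}_{\le n}$ can be written as $f=g\varphi$ for some homomorphism $g\colon X\to X'$. -/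

import Mathlib

open CategoryTheory
open scoped TensorProduct

universe u

noncomputable section

namespace WeakFlat

/-! ### Tensor products and `Tor` over a not necessarily commutative ring

Right `R`-modules are modules over the opposite ring `Rᵐᵒᵖ`; the right action of `r` on `m`
is `MulOpposite.op r • m`. -/

section Tensor

variable (R : Type u) [Ring R]
variable (M : Type u) [AddCommGroup M] [Module Rᵐᵒᵖ M]

/-- The subgroup of `M ⊗[ℤ] N` generated by all `m r ⊗ n - m ⊗ r n`. -/
def balancedRel (N : Type u) [AddCommGroup N] [Module R N] : Submodule ℤ (M ⊗[ℤ] N) :=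
  Submodule.span ℤ
    {t | ∃ (m : M) (r : R) (n : N), t = (MulOpposite.op r • m) ⊗ₜ[ℤ] n - m ⊗ₜ[ℤ] (r • n)}

/-- The tensor product `M ⊗_R N` of a right `R`-module `M` and a left `R`-module `N`. -/
abbrev BalancedTensor (N : Type u) [AddCommGroup N] [Module R N] : Type u :=
  (M ⊗[ℤ] N) ⧸ balancedRel R M N

variable {N N' : Type u} [AddCommGroup N] [Module R N] [AddCommGroup N'] [Module R N']

theorem balancedRel_le_comap (f : N →ₗ[R] N') :
    balancedRel R M N ≤
      (balancedRel R M N').comap (TensorProduct.map LinearMap.id f.toAddMonoidHom.toIntLinearMap) := by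
  refine Submodule.span_le.2 ?_
  rintro _ ⟨m, r, n, rfl⟩
  refine Submodule.subset_span ⟨m, r, f n, ?_⟩
  simp

/-- The homomorphism `M ⊗_R f : M ⊗_R N → M ⊗_R N'`, `m ⊗ n ↦ m ⊗ f n`. -/
def balancedMap (f : N →ₗ[R] N') : BalancedTensor R M N →ₗ[ℤ] BalancedTensor R M N' :=
  Submodule.mapQ _ _ (TensorProduct.map LinearMap.id f.toAddMonoidHom.toIntLinearMap)
    (balancedRel_le_comap R M f)

theorem balancedMap_mk_tmul (f : N →ₗ[R] N') (m : M) (n : N) :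
    balancedMap R M f ((balancedRel R M N).mkQ (m ⊗ₜ[ℤ] n)) =
      (balancedRel R M N').mkQ (m ⊗ₜ[ℤ] f n) := rfl

/-- Two homomorphisms out of `M ⊗_R N` agree if they agree on all `m ⊗ n`. -/
theorem balanced_ext {A : Type u} [AddCommGroup A] {f g : BalancedTensor R M N →ₗ[ℤ] A}
    (h : ∀ (m : M) (n : N), f ((balancedRel R M N).mkQ (m ⊗ₜ[ℤ] n)) =
      g ((balancedRel R M N).mkQ (m ⊗ₜ[ℤ] n))) : f = g :=
  Submodule.linearMap_qext _ (TensorProduct.ext' h)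

/-- The functor `M ⊗_R -` from left `R`-modules to abelian groups. -/
def tensorFunctor : ModuleCat.{u} R ⥤ ModuleCat.{u} ℤ where
  obj N := ModuleCat.of ℤ (BalancedTensor R M N)
  map f := ModuleCat.ofHom (balancedMap R M f.hom)
  map_id N := by
    apply ModuleCat.hom_ext
    exact balanced_ext R M fun m n => rfl
  map_comp f g := by
    apply ModuleCat.hom_ext
    exact balanced_ext R M fun m n => rfl

instance : (tensorFunctor R M).Additive where
  map_add {N N' f g} := by
    apply ModuleCat.hom_ext
    refine balanced_ext R M fun m n => ?_
    change (balancedRel R M N').mkQ (m ⊗ₜ[ℤ] (f.hom n + g.hom n)) =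
      (balancedRel R M N').mkQ (m ⊗ₜ[ℤ] f.hom n) + (balancedRel R M N').mkQ (m ⊗ₜ[ℤ] g.hom n)
    rw [TensorProduct.tmul_add, map_add]

/-- `Tor_n^R(M, N)`: the `n`-th left derived functor of `M ⊗_R -`, evaluated at `N`. -/
def Tor (n : ℕ) (N : ModuleCat.{u} R) : ModuleCat.{u} ℤ :=
  ((tensorFunctor R M).leftDerived n).obj N

end Tensor

/-! ### Weak flat dimension -/

/-- A left `R`-module is super finitely presented if it has a resolution by finitely generated
projective modules. -/
def IsSuperFinitelyPresented {R : Type u} [Ring R] (N : ModuleCat.{u} R) : Prop :=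
  ∃ P : ProjectiveResolution N, ∀ i, Module.Finite R (P.complex.X i)

/-- The weak flat dimension of a right `R`-module `M`: the smallest `n` such that
`Tor_{n+1}^R(M, N) = 0` for every super finitely presented left `R`-module `N`, and `∞` if there
is no such `n`. -/
def weakFlatDim (R : Type u) [Ring R] (M : ModuleCat.{u} Rᵐᵒᵖ) : ℕ∞ :=
  sInf {k | ∃ n : ℕ, k = n ∧
    ∀ N : ModuleCat.{u} R, IsSuperFinitelyPresented N → Subsingleton (Tor R M (n + 1) N)}

/-- The class of right `R`-modules of weak flat dimension at most `n`. -/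
def WFLE (R : Type u) [Ring R] (n : ℕ) : ObjectProperty (ModuleCat.{u} Rᵐᵒᵖ) :=
  fun M => weakFlatDim R M ≤ n

/-! ### Preenvelopes -/

/-- `φ : M ⟶ X` is a `C`-preenvelope of `M`: `X` belongs to `C`, and every homomorphism from `M`
to a module in `C` factors through `φ`. -/
def IsPreenvelope {S : Type u} [Ring S] (C : ObjectProperty (ModuleCat.{u} S))
    {M X : ModuleCat.{u} S} (φ : M ⟶ X) : Prop :=
  C X ∧ ∀ (X' : ModuleCat.{u} S), C X' → ∀ f : M ⟶ X', ∃ g : X ⟶ X', φ ≫ g = f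

/-- The class `C` is preenveloping: every module has a `C`-preenvelope. -/
def IsPreenveloping {S : Type u} [Ring S] (C : ObjectProperty (ModuleCat.{u} S)) : Prop :=
  ∀ M : ModuleCat.{u} S, ∃ (X : ModuleCat.{u} S) (φ : M ⟶ X), IsPreenvelope C φ

/-- The class `C` is closed under arbitrary direct products. -/
def IsClosedUnderProducts {S : Type u} [Ring S] (C : ObjectProperty (ModuleCat.{u} S)) : Prop :=
  ∀ (ι : Type u) (M : ι → ModuleCat.{u} S), (∀ i, C (M i)) → C (ModuleCat.of S (∀ i, M i))

end WeakFlat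

end

/-! Let `P` resolve `N` by finitely generated projectives. Then `Tor` of `M` and `N` vanishes in
degree `n + 1` iff `M ⊗ P` is exact there (`subsingleton_tor_iff`). Each term of `P` is a retract of
some `R ^ k`, so exactness says that certain finite linear systems over `R` with compatible right
hand side are solvable in `M` (`retractSystem_solvable_iff`). By dimension shifting (`wfle_iff`)
these systems define the whole class (`wfle_eq_solvableClass`).

Solvability passes to products coordinatewise. For preenvelopes, close the image of `f : M ⟶ X'`
under chosen solutions. The resulting submodule is in the class and consists of values of terms
built from `R` and `M` alone, hence is a quotient of a free module independent of `X'`. Such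
quotients, with maps from `M`, form a small family, and its product is a preenvelope. -/

noncomputable section

namespace WeakFlat

/-! ### Tensor products with finitely generated free modules -/

section Free

variable {R : Type u} [Ring R]

/-- The map `M ^ a → M ^ b` induced by a homomorphism `R ^ a → R ^ b`. -/
def powMap (M : Type u) [AddCommGroup M] [Module Rᵐᵒᵖ M] {a b : ℕ}
    (f : (Fin a → R) →ₗ[R] (Fin b → R)) : (Fin a → M) →+ (Fin b → M) where
  toFun x j := ∑ i, MulOpposite.op (f (Pi.single i 1) j) • x i
  map_zero' := by ext; simp
  map_add' x y := by ext; simp [Finset.sum_add_distrib]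

variable (M : Type u) [AddCommGroup M] [Module Rᵐᵒᵖ M]

theorem powMap_apply {a b : ℕ} (f : (Fin a → R) →ₗ[R] (Fin b → R)) (x : Fin a → M) (j : Fin b) :
    powMap M f x j = ∑ i, MulOpposite.op (f (Pi.single i 1) j) • x i := rfl

/-- The homomorphism `M ⊗_R R ^ k → M ^ k`, `m ⊗ v ↦ (m v_i)_i`. -/
def toPow (k : ℕ) : BalancedTensor R M (Fin k → R) →ₗ[ℤ] (Fin k → M) :=
  Submodule.liftQ _
    (TensorProduct.lift (LinearMap.mk₂ ℤ (fun (m : M) (v : Fin k → R) i => MulOpposite.op (v i) • m)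
      (fun _ _ _ => by ext; simp) (fun c m v => funext fun i => smul_comm (MulOpposite.op (v i)) c m)
      (fun _ _ _ => by ext; simp [add_smul]) (fun c m v => funext fun i => smul_assoc c (MulOpposite.op (v i)) m)))
    (by
      refine Submodule.span_le.2 ?_
      rintro _ ⟨m, r, v, rfl⟩
      refine LinearMap.mem_ker.2 ((map_sub _ _ _).trans (sub_eq_zero.2 ?_))
      exact funext fun i => smul_smul _ _ _)

theorem toPow_tmul (k : ℕ) (m : M) (v : Fin k → R) :
    toPow M k ((balancedRel R M _).mkQ (m ⊗ₜ[ℤ] v)) = fun i => MulOpposite.op (v i) • m := rfl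

/-- The homomorphism `M ^ k → M ⊗_R R ^ k`, `x ↦ ∑ x_i ⊗ e_i`. -/
def ofPow (k : ℕ) : (Fin k → M) →+ BalancedTensor R M (Fin k → R) where
  toFun x := ∑ i, (balancedRel R M _).mkQ (x i ⊗ₜ[ℤ] (Pi.single i 1 : Fin k → R))
  map_zero' := by simp
  map_add' x y := by simp only [Pi.add_apply, TensorProduct.add_tmul, map_add,
    Finset.sum_add_distrib]

theorem ofPow_apply (k : ℕ) (x : Fin k → M) : ofPow (R := R) M k x =
    ∑ i, (balancedRel R M _).mkQ (x i ⊗ₜ[ℤ] (Pi.single i 1 : Fin k → R)) := rfl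

theorem mkQ_smul_tmul {N : Type u} [AddCommGroup N] [Module R N] (m : M) (r : R) (n : N) :
    (balancedRel R M N).mkQ ((MulOpposite.op r • m) ⊗ₜ[ℤ] n) =
      (balancedRel R M N).mkQ (m ⊗ₜ[ℤ] (r • n)) := by
  rw [← sub_eq_zero, ← map_sub, Submodule.mkQ_apply, Submodule.Quotient.mk_eq_zero]
  exact Submodule.subset_span ⟨m, r, n, rfl⟩

theorem toPow_ofPow (k : ℕ) (x : Fin k → M) : toPow (R := R) M k (ofPow M k x) = x := by
  ext j
  rw [ofPow_apply, map_sum, Finset.sum_apply, Finset.sum_eq_single j]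
  · simp only [toPow_tmul, Pi.single_eq_same, MulOpposite.op_one, one_smul]
  · intro i _ hij
    simp only [toPow_tmul, Pi.single_eq_of_ne hij.symm, MulOpposite.op_zero, zero_smul]
  · simp

theorem ofPow_toPow (k : ℕ) (t : BalancedTensor R M (Fin k → R)) :
    ofPow M k (toPow M k t) = t := by
  have : (ofPow (R := R) M k).toIntLinearMap ∘ₗ toPow M k = LinearMap.id := by
    refine balanced_ext R M fun m v => ?_
    simp only [LinearMap.comp_apply, toPow_tmul, AddMonoidHom.coe_toIntLinearMap, ofPow_apply,
      LinearMap.id_apply, mkQ_smul_tmul]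
    rw [← map_sum, ← TensorProduct.tmul_sum]
    congr 2
    ext i
    simp [Finset.sum_apply, Pi.single_apply]
  exact LinearMap.congr_fun this t

/-- Expand `f v` over the standard basis; `op` reverses products, which matches the right action. -/
theorem toPow_balancedMap {a b : ℕ} (f : (Fin a → R) →ₗ[R] (Fin b → R))
    (t : BalancedTensor R M (Fin a → R)) :
    toPow M b (balancedMap R M f t) = powMap M f (toPow M a t) := by
  have : toPow M b ∘ₗ balancedMap R M f = (powMap M f).toIntLinearMap ∘ₗ toPow M a := by
    refine balanced_ext R M fun m v => ?_
    simp only [LinearMap.comp_apply, balancedMap_mk_tmul, toPow_tmul,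
      AddMonoidHom.coe_toIntLinearMap]
    ext j
    rw [powMap_apply]
    have hv : f v = ∑ i, v i • f (Pi.single i 1) := by
      simp only [← map_smul, ← map_sum]
      congr 1
      ext i
      simp [Pi.single_apply]
    rw [hv, Finset.sum_apply, Finset.op_sum, Finset.sum_smul]
    exact Finset.sum_congr rfl fun i _ => by
      rw [Pi.smul_apply, smul_eq_mul, MulOpposite.op_mul, mul_smul]
  exact LinearMap.congr_fun this t

theorem balancedMap_comp {N N' N'' : Type u} [AddCommGroup N] [Module R N] [AddCommGroup N']
    [Module R N'] [AddCommGroup N''] [Module R N''] (g : N' →ₗ[R] N'') (f : N →ₗ[R] N')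
    (t : BalancedTensor R M N) :
    balancedMap R M (g ∘ₗ f) t = balancedMap R M g (balancedMap R M f t) := by
  have : balancedMap R M (g ∘ₗ f) = balancedMap R M g ∘ₗ balancedMap R M f :=
    balanced_ext R M fun m n => rfl
  exact LinearMap.congr_fun this t

theorem balancedMap_id {N : Type u} [AddCommGroup N] [Module R N] (t : BalancedTensor R M N) :
    balancedMap R M LinearMap.id t = t := by
  have : balancedMap R M (LinearMap.id : N →ₗ[R] N) = LinearMap.id :=
    balanced_ext R M fun m n => rfl
  exact LinearMap.congr_fun this t

theorem balancedMap_balancedMap_of_leftInverse {N N' : Type u} [AddCommGroup N] [Module R N]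
    [AddCommGroup N'] [Module R N'] {f : N →ₗ[R] N'} {g : N' →ₗ[R] N}
    (h : g ∘ₗ f = LinearMap.id) (t : BalancedTensor R M N) :
    balancedMap R M g (balancedMap R M f t) = t := by
  rw [← balancedMap_comp, h, balancedMap_id]

theorem balancedMap_ofPow {a b : ℕ} (f : (Fin a → R) →ₗ[R] (Fin b → R)) (x : Fin a → M) :
    balancedMap R M f (ofPow M a x) = ofPow M b (powMap M f x) := by
  rw [← ofPow_toPow M b (balancedMap R M f _), toPow_balancedMap, toPow_ofPow]

/-- Homomorphisms between right modules commute with `powMap`. -/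
theorem map_powMap {M' : Type u} [AddCommGroup M'] [Module Rᵐᵒᵖ M'] (φ : M →ₗ[Rᵐᵒᵖ] M')
    {a b : ℕ} (f : (Fin a → R) →ₗ[R] (Fin b → R)) (x : Fin a → M) :
    powMap M' f (φ ∘ x) = φ ∘ powMap M f x := by
  ext j
  simp [powMap_apply]

/-! ### Linear systems -/

variable (R) in
/-- The datum of homomorphisms `R ^ a → R ^ b → R ^ c` and of an endomorphism of `R ^ b`. -/
structure LinearSystem where
  /-- The number of unknowns. -/
  a : ℕ
  /-- The number of equations. -/
  b : ℕ
  /-- The number of compatibility conditions. -/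
  c : ℕ
  /-- The matrix of the system. -/
  f : (Fin a → R) →ₗ[R] (Fin b → R)
  /-- The endomorphism fixing the right hand side. -/
  e : (Fin b → R) →ₗ[R] (Fin b → R)
  /-- The compatibility conditions. -/
  g : (Fin b → R) →ₗ[R] (Fin c → R)

/-- The right hand side `x` satisfies the compatibility conditions. -/
def LinearSystem.Compatible (j : LinearSystem R) (x : Fin j.b → M) : Prop :=
  powMap M j.e x = x ∧ powMap M j.g x = 0

/-- Every compatible right hand side has a solution in `M`. -/
def LinearSystem.Solvable (j : LinearSystem R) : Prop :=
  ∀ x : Fin j.b → M, j.Compatible M x → ∃ y, powMap M j.f y = x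

/-- The linear system attached to `P₂ → P₁ → P₀`, where each `P i` is a retract of `R ^ k i`. -/
def retractSystem {P₂ P₁ P₀ : Type u} [AddCommGroup P₂] [Module R P₂] [AddCommGroup P₁]
    [Module R P₁] [AddCommGroup P₀] [Module R P₀] (d₂ : P₂ →ₗ[R] P₁) (d₁ : P₁ →ₗ[R] P₀)
    {k₂ k₁ k₀ : ℕ} (p₂ : (Fin k₂ → R) →ₗ[R] P₂)
    (s₁ : P₁ →ₗ[R] (Fin k₁ → R)) (p₁ : (Fin k₁ → R) →ₗ[R] P₁)
    (s₀ : P₀ →ₗ[R] (Fin k₀ → R)) : LinearSystem R where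
  a := k₂
  b := k₁
  c := k₀
  f := s₁ ∘ₗ d₂ ∘ₗ p₂
  e := s₁ ∘ₗ p₁
  g := s₀ ∘ₗ d₁ ∘ₗ p₁

/-- The condition for `e = s₁ ∘ p₁` singles out the copy of `M ⊗ P₁` inside `M ^ k₁`; the one for
`g` cuts out the kernel of `d₁`. -/
theorem retractSystem_solvable_iff {P₂ P₁ P₀ : Type u} [AddCommGroup P₂] [Module R P₂]
    [AddCommGroup P₁] [Module R P₁] [AddCommGroup P₀] [Module R P₀] (d₂ : P₂ →ₗ[R] P₁)
    (d₁ : P₁ →ₗ[R] P₀) {k₂ k₁ k₀ : ℕ}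
    {s₂ : P₂ →ₗ[R] (Fin k₂ → R)} {p₂ : (Fin k₂ → R) →ₗ[R] P₂} (h₂ : p₂ ∘ₗ s₂ = LinearMap.id)
    {s₁ : P₁ →ₗ[R] (Fin k₁ → R)} {p₁ : (Fin k₁ → R) →ₗ[R] P₁} (h₁ : p₁ ∘ₗ s₁ = LinearMap.id)
    {s₀ : P₀ →ₗ[R] (Fin k₀ → R)} {p₀ : (Fin k₀ → R) →ₗ[R] P₀} (h₀ : p₀ ∘ₗ s₀ = LinearMap.id) :
    (retractSystem d₂ d₁ p₂ s₁ p₁ s₀).Solvable M ↔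
      ∀ t : BalancedTensor R M P₁, balancedMap R M d₁ t = 0 → ∃ s, balancedMap R M d₂ s = t := by
  have key : (retractSystem d₂ d₁ p₂ s₁ p₁ s₀).Solvable M ↔ ∀ x : Fin k₁ → M,
      powMap M (s₁ ∘ₗ p₁) x = x → powMap M (s₀ ∘ₗ d₁ ∘ₗ p₁) x = 0 →
        ∃ y, powMap M (s₁ ∘ₗ d₂ ∘ₗ p₂) y = x :=
    ⟨fun h x he hg => h x ⟨he, hg⟩, fun h x hx => h x hx.1 hx.2⟩
  rw [key]
  constructor
  · intro h t ht
    obtain ⟨y, hy⟩ := h (toPow M k₁ (balancedMap R M s₁ t))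
      (by rw [← toPow_balancedMap, balancedMap_comp, balancedMap_balancedMap_of_leftInverse M h₁])
      (by rw [← toPow_balancedMap, balancedMap_comp, balancedMap_comp,
        balancedMap_balancedMap_of_leftInverse M h₁, ht, map_zero, map_zero])
    refine ⟨balancedMap R M p₂ (ofPow M k₂ y), ?_⟩
    -- Applying `p₁` cancels `s₁` on both sides.
    have h := congrArg (fun z => balancedMap R M p₁ (ofPow M k₁ z)) hy
    simp only [← balancedMap_ofPow, ofPow_toPow, balancedMap_comp,
      balancedMap_balancedMap_of_leftInverse M h₁] at h
    exact h
  · intro h x he hg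
    -- Tensoring keeps `s₀` injective, with left inverse `p₀`, so the condition for `g` already
    -- kills `d₁`.
    obtain ⟨s, hs⟩ := h (balancedMap R M p₁ (ofPow M k₁ x)) (by
      rw [← balancedMap_balancedMap_of_leftInverse M h₀ (balancedMap R M d₁ _),
        ← balancedMap_comp M d₁, ← balancedMap_comp M s₀, balancedMap_ofPow, hg, map_zero,
        map_zero])
    refine ⟨toPow M k₂ (balancedMap R M s₂ s), ?_⟩
    rw [← toPow_balancedMap, balancedMap_comp, balancedMap_comp,
      balancedMap_balancedMap_of_leftInverse M h₂, hs, ← balancedMap_comp, toPow_balancedMap,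
      toPow_ofPow, he]

/-- The modules in which every system of a given set is solvable. -/
def solvableClass (S : Set (LinearSystem R)) : ObjectProperty (ModuleCat.{u} Rᵐᵒᵖ) :=
  fun M => ∀ j ∈ S, j.Solvable M

theorem solvableClass_isClosedUnderProducts (S : Set (LinearSystem R)) :
    IsClosedUnderProducts (solvableClass S) := by
  intro ι M hM j hj x hx
  have key : ∀ i, ∃ y, powMap (M i) j.f y = fun l => x l i := fun i =>
    hM i j hj _ ⟨
      (map_powMap _ (LinearMap.proj (R := Rᵐᵒᵖ) (φ := fun i => M i) i) j.e x).trans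
        (by rw [hx.1]; rfl),
      (map_powMap _ (LinearMap.proj (R := Rᵐᵒᵖ) (φ := fun i => M i) i) j.g x).trans
        (by rw [hx.2]; rfl)⟩
  choose y hy using key
  refine ⟨fun l i => y i l, ?_⟩
  ext l i
  have := map_powMap _ (LinearMap.proj (R := Rᵐᵒᵖ) (φ := fun i => M i) i) j.f (fun l i => y i l)
  exact (congrFun this l).symm.trans (congrFun (hy i) l)

/-- Solvability is invariant under isomorphisms. -/
theorem LinearSystem.Solvable.of_equiv {j : LinearSystem R} {M M' : Type u} [AddCommGroup M]
    [Module Rᵐᵒᵖ M] [AddCommGroup M'] [Module Rᵐᵒᵖ M'] (φ : M ≃ₗ[Rᵐᵒᵖ] M')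
    (h : j.Solvable M) : j.Solvable M' := by
  rintro x ⟨he, hg⟩
  obtain ⟨y, hy⟩ := h (φ.symm ∘ x) ⟨
    (map_powMap _ φ.symm.toLinearMap j.e x).trans (by rw [he]; rfl),
    (map_powMap _ φ.symm.toLinearMap j.g x).trans (by rw [hg]; ext; simp)⟩
  refine ⟨φ ∘ y, (map_powMap _ φ.toLinearMap j.f y).trans ?_⟩
  rw [hy]
  ext
  simp

/-! ### Preenvelopes -/

/-- Formal expressions in elements of `M` and in solutions of linear systems. -/
inductive SolutionTerm (R : Type u) [Ring R] (M : Type u) : Type u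
  | of (m : M) : SolutionTerm R M
  | zero : SolutionTerm R M
  | add (s t : SolutionTerm R M) : SolutionTerm R M
  | smul (r : R) (t : SolutionTerm R M) : SolutionTerm R M
  | solution (j : LinearSystem R) (x : Fin j.b → SolutionTerm R M) (i : Fin j.a) :
      SolutionTerm R M

/-- The value of a formal expression, given a choice of solutions. -/
def SolutionTerm.eval {M X : Type u} [AddCommGroup X] [Module Rᵐᵒᵖ X] (f : M → X)
    (sol : ∀ j : LinearSystem R, (Fin j.b → X) → (Fin j.a → X)) : SolutionTerm R M → X
  | .of m => f m
  | .zero => 0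
  | .add s t => s.eval f sol + t.eval f sol
  | .smul r t => MulOpposite.op r • t.eval f sol
  | .solution j x i => sol j (fun l => (x l).eval f sol) i

/-- The submodule of all values of formal expressions. -/
def solutionHull {M X : Type u} [AddCommGroup X] [Module Rᵐᵒᵖ X] (f : M → X)
    (sol : ∀ j : LinearSystem R, (Fin j.b → X) → (Fin j.a → X)) : Submodule Rᵐᵒᵖ X where
  carrier := Set.range (SolutionTerm.eval f sol)
  zero_mem' := ⟨.zero, rfl⟩
  add_mem' := by rintro _ _ ⟨s, rfl⟩ ⟨t, rfl⟩; exact ⟨.add s t, rfl⟩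
  smul_mem' := by rintro r _ ⟨t, rfl⟩; exact ⟨.smul r.unop t, rfl⟩

theorem solutionHull_solvable {M X : Type u} [AddCommGroup X] [Module Rᵐᵒᵖ X] (f : M → X)
    (sol : ∀ j : LinearSystem R, (Fin j.b → X) → (Fin j.a → X)) {j : LinearSystem R}
    (hj : ∀ x, j.Compatible X x → powMap X j.f (sol j x) = x) :
    j.Solvable (solutionHull f sol) := by
  rintro x ⟨he, hg⟩
  have hx := hj (fun l => (x l : X)) ⟨
    (map_powMap _ (solutionHull f sol).subtype j.e x).trans (by rw [he]; rfl),
    (map_powMap _ (solutionHull f sol).subtype j.g x).trans (by rw [hg]; rfl)⟩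
  choose t ht using fun l => (x l).2
  -- The coordinates of `x` are values of terms `t`, so the chosen solution is again a value of
  -- terms.
  have hs : ∀ i, sol j (fun l => (x l : X)) i ∈ solutionHull f sol := fun i =>
    ⟨.solution j t i, by simp only [SolutionTerm.eval, ht]⟩
  refine ⟨fun i => ⟨_, hs i⟩, ?_⟩
  have := map_powMap _ (solutionHull f sol).subtype j.f fun i => ⟨_, hs i⟩
  ext l
  exact (congrFun this l).symm.trans (congrFun hx l)

/-- A class closed under products is preenveloping if, for every module, some small family of
homomorphisms into the class suffices to factor all others. -/
theorem IsClosedUnderProducts.isPreenveloping {A : Type u} [Ring A]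
    {C : ObjectProperty (ModuleCat.{u} A)} (hC : IsClosedUnderProducts C)
    (h : ∀ M : ModuleCat.{u} A, ∃ (I : Type u) (X : I → ModuleCat.{u} A) (φ : ∀ i, M ⟶ X i),
      (∀ i, C (X i)) ∧ ∀ X', C X' → ∀ f : M ⟶ X', ∃ i, ∃ g : X i ⟶ X', φ i ≫ g = f) :
    IsPreenveloping C := by
  intro M
  obtain ⟨I, X, φ, hX, hφ⟩ := h M
  refine ⟨ModuleCat.of A (∀ i, X i), ModuleCat.ofHom (LinearMap.pi fun i => (φ i).hom),
    hC I X hX, fun X' hX' f => ?_⟩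
  obtain ⟨i, g, hg⟩ := hφ X' hX' f
  refine ⟨ModuleCat.ofHom (g.hom ∘ₗ LinearMap.proj (R := A) (φ := fun i => X i) i), ?_⟩
  rw [← hg]
  rfl

theorem solvableClass_isPreenveloping (S : Set (LinearSystem R)) :
    IsPreenveloping (solvableClass S) := by
  refine (solvableClass_isClosedUnderProducts S).isPreenveloping fun M => ?_
  -- `F` and `I` lie in `Type u` and are fixed before `X'` is given.
  let F : Type u := SolutionTerm R M →₀ Rᵐᵒᵖ
  let I : Type u := Σ Q : {Q : Submodule Rᵐᵒᵖ F // solvableClass S (ModuleCat.of _ (F ⧸ Q))},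
    M →ₗ[Rᵐᵒᵖ] (F ⧸ Q.1)
  refine ⟨I, fun i => ModuleCat.of _ (F ⧸ i.1.1), fun i => ModuleCat.ofHom i.2,
    fun i => i.1.2, ?_⟩
  intro X' hX' f
  -- `eval` needs a total choice of solutions; `0` serves outside `S` or for incompatible `x`.
  have hsol : ∀ (j : LinearSystem R) (x : Fin j.b → X'), ∃ y : Fin j.a → X',
      j ∈ S → j.Compatible X' x → powMap X' j.f y = x := by
    intro j x
    by_cases h : j ∈ S ∧ j.Compatible X' x
    · obtain ⟨y, hy⟩ := hX' j h.1 x h.2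
      exact ⟨y, fun _ _ => hy⟩
    · exact ⟨0, fun h₁ h₂ => (h ⟨h₁, h₂⟩).elim⟩
  choose sol hsol using hsol
  let H := solutionHull f.hom sol
  let q : F →ₗ[Rᵐᵒᵖ] H := Finsupp.linearCombination Rᵐᵒᵖ
    fun t => (⟨t.eval f.hom sol, t, rfl⟩ : H)
  have hq : Function.Surjective q := by
    rintro ⟨_, t, rfl⟩
    exact ⟨Finsupp.single t 1, (Finsupp.linearCombination_single _ _ _).trans (one_smul _ _)⟩
  let ε : (F ⧸ LinearMap.ker q) ≃ₗ[Rᵐᵒᵖ] H := q.quotKerEquivOfSurjective hq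
  let f' : M →ₗ[Rᵐᵒᵖ] H := f.hom.codRestrict H fun m => ⟨.of m, rfl⟩
  let i : I := ⟨⟨LinearMap.ker q, fun j hj => LinearSystem.Solvable.of_equiv ε.symm
    (solutionHull_solvable f.hom sol fun x => hsol j x hj)⟩, ε.symm.toLinearMap ∘ₗ f'⟩
  refine ⟨i, ModuleCat.ofHom (H.subtype ∘ₗ ε.toLinearMap), ?_⟩
  ext m
  change ((ε (ε.symm (f' m)) : H) : X') = f.hom m
  rw [LinearEquiv.apply_symm_apply]
  rfl

end Free

/-! ### Weak flat dimension and linear systems -/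

section Resolution

variable {R : Type u} [Ring R]

theorem subsingleton_tor_iff (M : Type u) [AddCommGroup M] [Module Rᵐᵒᵖ M]
    {N : ModuleCat.{u} R} (P : ProjectiveResolution N) (n : ℕ) :
    Subsingleton (Tor R M (n + 1) N) ↔
      ∀ t : BalancedTensor R M (P.complex.X (n + 1)),
        balancedMap R M (P.complex.d (n + 1) n).hom t = 0 →
          ∃ s, balancedMap R M (P.complex.d (n + 2) (n + 1)).hom s = t := by
  let K := ((tensorFunctor R M).mapHomologicalComplex (ComplexShape.down ℕ)).obj P.complex
  have e : Tor R M (n + 1) N ≅ K.homology (n + 1) := P.isoLeftDerivedObj (tensorFunctor R M) (n + 1)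
  rw [← ModuleCat.isZero_iff_subsingleton, e.isZero_iff,
    ← HomologicalComplex.exactAt_iff_isZero_homology,
    K.exactAt_iff' (n + 2) (n + 1) n (by simp) (by simp), ShortComplex.moduleCat_exact_iff]
  rfl

/-- The image of the first differential of a resolution is resolved by the truncated complex. -/
def syzygyResolution {N : ModuleCat.{u} R} (P : ProjectiveResolution N) :
    ProjectiveResolution (ModuleCat.of R (LinearMap.range (P.complex.d 1 0).hom)) where
  complex := ChainComplex.truncate.obj P.complex
  projective n := P.projective (n + 1)
  π := (ChainComplex.toSingle₀Equiv _ _).symm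
    ⟨ModuleCat.ofHom (P.complex.d 1 0).hom.rangeRestrict, by
      refine ModuleCat.hom_ext (LinearMap.ext fun x => Subtype.ext ?_)
      exact LinearMap.congr_fun (congrArg ModuleCat.Hom.hom (P.complex.d_comp_d 2 1 0)) x⟩
  quasiIso := ⟨fun n => by
    cases n with
    | zero =>
      -- In degree zero this asks for exactness of `P` at degree 1 and surjectivity onto the range.
      rw [ChainComplex.quasiIsoAt₀_iff, ShortComplex.quasiIso_iff_of_zeros']
      · refine ⟨?_, ?_⟩
        · rw [ShortComplex.moduleCat_exact_iff]
          intro x hx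
          refine (ShortComplex.moduleCat_exact_iff _).1 (P.exact_succ 0) x ?_
          exact congrArg Subtype.val hx
        · rw [ModuleCat.epi_iff_surjective]
          exact LinearMap.surjective_rangeRestrict (P.complex.d 1 0).hom
      · exact (ChainComplex.truncate.obj P.complex).shape 0 0 (by simp)
      all_goals rfl
    | succ n =>
      rw [quasiIsoAt_iff_exactAt' _ _ (ChainComplex.exactAt_succ_single_obj _ _),
        HomologicalComplex.exactAt_iff' _ (n + 2) (n + 1) n (by simp) (by simp)]
      exact P.exact_succ (n + 1)⟩

/-- Dimension shifting: the syzygy is super finitely presented, and its truncated resolution gives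
the same three-term sequence one degree lower. -/
theorem subsingleton_tor_succ {M : Type u} [AddCommGroup M] [Module Rᵐᵒᵖ M] {n : ℕ}
    (h : ∀ N : ModuleCat.{u} R, IsSuperFinitelyPresented N → Subsingleton (Tor R M (n + 1) N))
    (N : ModuleCat.{u} R) (hN : IsSuperFinitelyPresented N) :
    Subsingleton (Tor R M (n + 2) N) := by
  obtain ⟨P, hP⟩ := hN
  have := h _ ⟨syzygyResolution P, fun i => hP (i + 1)⟩
  rw [subsingleton_tor_iff M (syzygyResolution P)] at this
  rw [subsingleton_tor_iff M P]
  exact this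

theorem wfle_iff (n : ℕ) (M : ModuleCat.{u} Rᵐᵒᵖ) :
    WFLE R n M ↔
      ∀ N : ModuleCat.{u} R, IsSuperFinitelyPresented N → Subsingleton (Tor R M (n + 1) N) := by
  refine ⟨fun h => ?_, fun h => sInf_le ⟨n, rfl, h⟩⟩
  let s : Set ℕ∞ := {k | ∃ n : ℕ, k = n ∧
    ∀ N : ModuleCat.{u} R, IsSuperFinitelyPresented N → Subsingleton (Tor R M (n + 1) N)}
  change sInf s ≤ n at h
  -- The infimum of the empty set is `⊤`, which is not at most `n`; a nonempty `s` attains its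
  -- infimum.
  have hs : s.Nonempty := by
    by_contra hs
    rw [Set.not_nonempty_iff_eq_empty.1 hs, sInf_empty] at h
    exact absurd h (by simp)
  obtain ⟨m, hm, hT⟩ := csInf_mem hs
  rw [hm, Nat.cast_le] at h
  clear hm
  induction n, h using Nat.le_induction with
  | base => exact hT
  | succ k _ ih => exact subsingleton_tor_succ ih

theorem exists_retraction (P : ModuleCat.{u} R) [Projective P] [Module.Finite R P] :
    ∃ (k : ℕ) (s : P →ₗ[R] (Fin k → R)) (p : (Fin k → R) →ₗ[R] P), p ∘ₗ s = LinearMap.id := by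
  obtain ⟨k, p, hp⟩ := Module.Finite.exists_fin' R P
  have : Module.Projective R P := (IsProjective.iff_projective P).2 inferInstance
  obtain ⟨s, hs⟩ := Module.projective_lifting_property p LinearMap.id hp
  exact ⟨k, s, p, hs⟩

/-- The systems attached to degree `n + 1` of resolutions by finitely generated projectives. -/
def resolutionSystems (R : Type u) [Ring R] (n : ℕ) : Set (LinearSystem R) :=
  {j | ∃ (N : ModuleCat.{u} R) (P : ProjectiveResolution N) (k₂ k₁ k₀ : ℕ)
    (s₂ : P.complex.X (n + 2) →ₗ[R] (Fin k₂ → R)) (p₂ : (Fin k₂ → R) →ₗ[R] P.complex.X (n + 2))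
    (s₁ : P.complex.X (n + 1) →ₗ[R] (Fin k₁ → R)) (p₁ : (Fin k₁ → R) →ₗ[R] P.complex.X (n + 1))
    (s₀ : P.complex.X n →ₗ[R] (Fin k₀ → R)) (p₀ : (Fin k₀ → R) →ₗ[R] P.complex.X n),
    (∀ i, Module.Finite R (P.complex.X i)) ∧ p₂ ∘ₗ s₂ = LinearMap.id ∧ p₁ ∘ₗ s₁ = LinearMap.id ∧
    p₀ ∘ₗ s₀ = LinearMap.id ∧
    j = retractSystem (P.complex.d (n + 2) (n + 1)).hom (P.complex.d (n + 1) n).hom p₂ s₁ p₁ s₀}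

theorem wfle_eq_solvableClass (n : ℕ) : WFLE R n = solvableClass (resolutionSystems R n) := by
  ext M
  rw [wfle_iff]
  constructor
  · rintro h _ ⟨N, P, k₂, k₁, k₀, s₂, p₂, s₁, p₁, s₀, p₀, hP, h₂, h₁, h₀, rfl⟩
    rw [retractSystem_solvable_iff M _ _ h₂ h₁ h₀]
    exact (subsingleton_tor_iff M P n).1 (h N ⟨P, hP⟩)
  · rintro h N ⟨P, hP⟩
    obtain ⟨k₂, s₂, p₂, h₂⟩ := exists_retraction (P.complex.X (n + 2))
    obtain ⟨k₁, s₁, p₁, h₁⟩ := exists_retraction (P.complex.X (n + 1))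
    obtain ⟨k₀, s₀, p₀, h₀⟩ := exists_retraction (P.complex.X n)
    exact (subsingleton_tor_iff M P n).2 ((retractSystem_solvable_iff M _ _ h₂ h₁ h₀).1
      (h _ ⟨N, P, k₂, k₁, k₀, s₂, p₂, s₁, p₁, s₀, p₀, hP, h₂, h₁, h₀, rfl⟩))

end Resolution

end WeakFlat

end

theorem mainTheorem4 (R : Type u) [Ring R] (n : ℕ) :
    WeakFlat.IsClosedUnderProducts (WeakFlat.WFLE R n) ∧
      WeakFlat.IsPreenveloping (WeakFlat.WFLE R n) := by
  rw [WeakFlat.wfle_eq_solvableClass]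
  exact ⟨WeakFlat.solvableClass_isClosedUnderProducts _,
    WeakFlat.solvableClass_isPreenveloping _⟩
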